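/- All graphs are finite, undirected, without loops or multiple edges. An edge-coloring of a graph $G$ with colors $1,2,\ldots,t$ is called an interval $t$-coloring if each color $i\in\{1,\ldots,t\}$ is used on at least one edge of $G$ and, for every vertex, the colors of the edges incident to it are distinct and form an interval of integers. $G$ is interval colorable if it has an interval $t$-coloring for some $t\ge 1$; in that case $W(G)$ denotes the greatest $t$ for which $G$ has an interval $t$-coloring. Theorem. If $G$ is a connected $r$-regular graph with $|V(G)|\ge 2r+2$ and $G$ is interval colorable, then $W(G)\le 2|V(G)|-5$. -/

import Mathlib

namespace SimpleGraph

variable {V : Type*} {G : SimpleGraph V}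

/-- The set of (indices of) edges of `G` that are incident to the vertex `v`. -/
def edgesAt (G : SimpleGraph V) (v : V) : Set G.edgeSet :=
  {e | v ∈ (e : Sym2 V)}

/-- `α` is an interval `t`-coloring of `G`: it uses only colors from `{1, …, t}` and each of them
on at least one edge; the colors of the edges incident to any vertex are pairwise distinct, and
they form an interval of integers (the empty interval at an isolated vertex). -/
structure IsIntervalColoring (G : SimpleGraph V) (t : ℕ) (α : G.edgeSet → ℕ) : Prop where
  /-- every edge has a color in `{1, …, t}` -/
  mem_Icc : ∀ e, α e ∈ Set.Icc 1 t
  /-- every color in `{1, …, t}` is used -/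
  exists_eq : ∀ i ∈ Set.Icc 1 t, ∃ e, α e = i
  /-- edges with a common endpoint have distinct colors -/
  injOn : ∀ v, Set.InjOn α (G.edgesAt v)
  /-- the colors at each vertex form an interval -/
  interval : ∀ v, ∃ a b : ℕ, α '' G.edgesAt v = Set.Icc a b

/-- The set of all `t ≥ 1` such that `G` has an interval `t`-coloring. -/
def intervalColorNumbers (G : SimpleGraph V) : Set ℕ :=
  {t | 1 ≤ t ∧ ∃ α : G.edgeSet → ℕ, G.IsIntervalColoring t α}

/-- `G` is interval colorable: it has an interval `t`-coloring for some `t ≥ 1`. -/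
def IntervalColorable (G : SimpleGraph V) : Prop :=
  ∃ t : ℕ, 1 ≤ t ∧ ∃ α : G.edgeSet → ℕ, G.IsIntervalColoring t α

/-- `W(G)`: the greatest `t` for which `G` has an interval `t`-coloring
(a genuine maximum for finite interval colorable graphs, see `isGreatest_maxIntervalColors`). -/
noncomputable def maxIntervalColors (G : SimpleGraph V) : ℕ :=
  sSup G.intervalColorNumbers

/-- For a finite interval colorable graph, `W(G)` is attained and is the maximum. -/
theorem isGreatest_maxIntervalColors [Finite V] (h : G.IntervalColorable) :
    IsGreatest G.intervalColorNumbers G.maxIntervalColors := by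
  have hb : BddAbove G.intervalColorNumbers := by
    refine ⟨Nat.card G.edgeSet, ?_⟩
    rintro t ⟨-, α, hα⟩
    have hs : Set.Icc 1 t ⊆ Set.range α := fun i hi => hα.exists_eq i hi
    have h1 := Set.ncard_le_ncard hs (Set.finite_range _)
    have h2 : (Set.range α).ncard ≤ Nat.card G.edgeSet := by
      rw [← Set.image_univ, ← Set.ncard_univ]
      exact Set.ncard_image_le Set.finite_univ
    have h3 : (Set.Icc 1 t).ncard = t := by
      rw [← Finset.coe_Icc, Set.ncard_coe_finset]
      simp
    omega
  have hne : G.intervalColorNumbers.Nonempty := h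
  exact ⟨Nat.sSup_mem hne hb, fun t ht => le_csSup hb ht⟩

end SimpleGraph

/-! Take two copies of `G`, lift each edge to its two cross edges, and join the copies of each
vertex by a rung. This bipartite graph is connected, (r+1)-regular and has N = 2|V| vertices. Lifted
edges keep their colors. A rung gets the color just above those at its vertex, except that at an end
of an edge of color 1 it gets 0. The result is an interval coloring with rungs of color 0 and of
color at least t + 1, so it suffices that colors in the cover differ by at most N - 4
(`Connected.color_add_four_le`).

For that bound, join two edges by a shortest walk. Each rise of the color at an inner vertex is paid
for by the neighbors whose colors are skipped there. Among shortest walks take the one with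
lexicographically least color sequence: if two inner vertices skipped the same neighbor, rerouting
through it would give a smaller sequence. Hence the skipped sets are disjoint, and with the walk
they give N - 2; one spare neighbor at each end of the walk improves this to N - 4. -/

namespace SimpleGraph

/-! ### Shortest and lexicographically least walks between edges -/

/-- `v 0, …, v (m + 1)` is a walk whose first edge is `ab` and whose last edge is `a'b'`, each
traversed in either direction. -/
structure IsEdgeWalk {W : Type*} (H : SimpleGraph W) (a b a' b' : W) (m : ℕ) (v : ℕ → W) :
    Prop where
  adj : ∀ i ≤ m, H.Adj (v i) (v (i + 1))
  first : v 0 = a ∧ v 1 = b ∨ v 0 = b ∧ v 1 = a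
  last : v m = a' ∧ v (m + 1) = b' ∨ v m = b' ∧ v (m + 1) = a'

theorem exists_isEdgeWalk_of_walk {W : Type*} {H : SimpleGraph W} {a b a' b' x y x' y' : W}
    (hx : x = a ∧ y = b ∨ x = b ∧ y = a) (hx' : x' = a' ∧ y' = b' ∨ x' = b' ∧ y' = a')
    (hxy : H.Adj x y) (hxy' : H.Adj x' y') (p : H.Walk y x') :
    ∃ v, H.IsEdgeWalk a b a' b' (p.length + 1) v := by
  refine ⟨fun i => if i = 0 then x else if i = p.length + 2 then y' else p.getVert (i - 1),
    ⟨?_, ?_, ?_⟩⟩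
  · intro i hi
    rcases i with _ | i
    · simpa using hxy
    · rcases Nat.lt_or_ge i p.length with h | h
      · have := p.adj_getVert_succ h
        simpa [show i ≠ p.length + 1 by omega, show i ≠ p.length by omega] using this
      · obtain rfl : i = p.length := by omega
        simpa using hxy'
  · simpa using hx
  · simpa using hx'

/-- A shortest walk between two edges, together with the level function it realizes. -/
theorem Connected.exists_isEdgeWalk {W : Type*} {H : SimpleGraph W} (hconn : H.Connected)
    {a b a' b' : W} (hab : H.Adj a b) (hab' : H.Adj a' b') :
    ∃ (m : ℕ) (L : W → ℕ), 1 ≤ m ∧ L a = 1 ∧ L b = 1 ∧ m ≤ L a' ∧ m ≤ L b' ∧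
      (∀ x y, H.Adj x y → L y ≤ L x + 1) ∧ ∃ v, H.IsEdgeWalk a b a' b' m v := by
  -- Distance to the edge `ab`, shifted by one so that `v i` has level `i` for 1 ≤ i ≤ m on a
  -- shortest walk.
  set L : W → ℕ := fun x => min (H.dist a x) (H.dist b x) + 1 with hL
  have key : ∀ x', ∃ x y, (x = a ∧ y = b ∨ x = b ∧ y = a) ∧ H.Adj x y ∧
      ∃ p : H.Walk y x', p.length + 1 = L x' := by
    intro x'
    rcases le_total (H.dist a x') (H.dist b x') with h | h
    · obtain ⟨p, hp⟩ := hconn.exists_walk_length_eq_dist a x'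
      exact ⟨b, a, by simp, hab.symm, p, by simp [hL, h, hp]⟩
    · obtain ⟨p, hp⟩ := hconn.exists_walk_length_eq_dist b x'
      exact ⟨a, b, by simp, hab, p, by simp [hL, h, hp]⟩
  have hw : ∃ v, H.IsEdgeWalk a b a' b' (min (L a') (L b')) v := by
    rcases le_total (L a') (L b') with h | h
    · obtain ⟨x, y, hx, hxy, p, hp⟩ := key a'
      rw [min_eq_left h, ← hp]
      exact exists_isEdgeWalk_of_walk hx (.inl ⟨rfl, rfl⟩) hxy hab' p
    · obtain ⟨x, y, hx, hxy, p, hp⟩ := key b'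
      rw [min_eq_right h, ← hp]
      exact exists_isEdgeWalk_of_walk hx (.inr ⟨rfl, rfl⟩) hxy hab'.symm p
  refine ⟨_, L, ?_, ?_, ?_, min_le_left _ _, min_le_right _ _, ?_, hw⟩
  · simp [hL]
  · simp [hL]
  · simp [hL]
  · intro x y hxy
    have h1 := hconn.dist_triangle (u := a) (v := x) (w := y)
    have h2 := hconn.dist_triangle (u := b) (v := x) (w := y)
    rw [dist_eq_one_iff_adj.2 hxy] at h1 h2
    simp only [hL]
    omega

/-- Among the edge walks of a given length, one with lexicographically least color sequence. -/
theorem exists_lexMin_isEdgeWalk {W : Type*} {H : SimpleGraph W} {a b a' b' : W} {m : ℕ}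
    (c : W → W → ℕ) (h : ∃ v, H.IsEdgeWalk a b a' b' m v) :
    ∃ v, H.IsEdgeWalk a b a' b' m v ∧ ∀ v', H.IsEdgeWalk a b a' b' m v' → ∀ i ≤ m,
      (∀ j < i, c (v' j) (v' (j + 1)) = c (v j) (v (j + 1))) →
      c (v i) (v (i + 1)) ≤ c (v' i) (v' (i + 1)) := by
  let f : (ℕ → W) → Lex (Fin (m + 1) → ℕ) := fun v => toLex fun i => c (v i) (v (i + 1))
  obtain ⟨v, hv, hmin⟩ := (InvImage.wf f wellFounded_lt).has_min
    {v | H.IsEdgeWalk a b a' b' m v} h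
  refine ⟨v, hv, fun v' hv' i hi hj => ?_⟩
  by_contra! hlt
  exact hmin v' hv' ⟨⟨i, by omega⟩, fun j hj' => hj j hj', hlt⟩

/-- An exchange: an inner vertex of an edge walk can be replaced by another common neighbor. -/
theorem IsEdgeWalk.update {W : Type*} [DecidableEq W] {H : SimpleGraph W} {a b a' b' : W} {m : ℕ}
    {v : ℕ → W} (hv : H.IsEdgeWalk a b a' b' m v) {i : ℕ} (hi : 1 ≤ i) (him : i + 2 ≤ m) {w : W}
    (h1 : H.Adj (v i) w) (h2 : H.Adj (v (i + 2)) w) :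
    H.IsEdgeWalk a b a' b' m (Function.update v (i + 1) w) := by
  refine ⟨fun j hj => ?_, ?_, ?_⟩
  · have := hv.adj j hj
    rcases eq_or_ne j i with rfl | hji
    · simpa using h1
    rcases eq_or_ne j (i + 1) with rfl | hji'
    · simpa using h2.symm
    simpa [Function.update_of_ne, hji, hji'] using this
  · simpa [Function.update_of_ne, show 0 ≠ i + 1 by omega, show i ≠ 0 by omega] using hv.first
  · simpa [Function.update_of_ne, show m ≠ i + 1 by omega, show m ≠ i by omega] using hv.last

/-! ### The color spread in a regular bipartite graph -/

/-- The colors at `x` strictly between `p` and `q` are seen on at least `q - p - 1` edges. -/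
theorem le_card_filter_between {W : Type*} [Fintype W] [DecidableEq W] {H : SimpleGraph W}
    [DecidableRel H.Adj] {k l : ℕ} {c : W → W → ℕ} {x y z : W}
    (hx : (H.neighborFinset x).image (c x) = Finset.Ico l (l + k))
    (hy : H.Adj x y) (hz : H.Adj x z) :
    c x z ≤ c x y + ({w ∈ H.neighborFinset x | c x y < c x w ∧ c x w < c x z} : Finset W).card
      + 1 := by
  have hmem : ∀ y, H.Adj x y → c x y ∈ Finset.Ico l (l + k) := fun y h => by
    rw [← hx]; exact Finset.mem_image_of_mem _ (by simpa using h)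
  have hyl := hmem y hy
  have hzl := hmem z hz
  have hsub : Finset.Ioo (c x y) (c x z) ⊆
      ({w ∈ H.neighborFinset x | c x y < c x w ∧ c x w < c x z} : Finset W).image (c x) := by
    intro i hi
    have hil : i ∈ Finset.Ico l (l + k) := by simp only [Finset.mem_Ico, Finset.mem_Ioo] at *; omega
    rw [← hx, Finset.mem_image] at hil
    obtain ⟨w, hw, rfl⟩ := hil
    exact Finset.mem_image_of_mem _ (Finset.mem_filter.2 ⟨hw, Finset.mem_Ioo.1 hi⟩)
  have := (Finset.card_le_card hsub).trans Finset.card_image_le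
  rw [Nat.card_Ioo] at this
  omega

/-- In an interval coloring of a connected `k`-regular bipartite graph on at least `4 * k`
vertices, the colors of any two edges differ by at most the number of vertices minus four. -/
theorem Connected.color_add_four_le {W : Type*} [Fintype W] [DecidableEq W] {H : SimpleGraph W}
    [DecidableRel H.Adj] {k : ℕ} (hconn : H.Connected) (hreg : H.IsRegularOfDegree k)
    {s : W → Bool} (hs : ∀ x y, H.Adj x y → s x ≠ s y) {c : W → W → ℕ}
    (hsymm : ∀ x y, c x y = c y x)
    (hc : ∀ x, ∃ l, (H.neighborFinset x).image (c x) = Finset.Ico l (l + k))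
    (hcard : 4 * k ≤ Fintype.card W) {a b a' b' : W} (hab : H.Adj a b) (hab' : H.Adj a' b') :
    c a' b' + 4 ≤ c a b + Fintype.card W := by
  obtain ⟨m, L, hm, hLa, hLb, hLa', hLb', hL, hex⟩ := hconn.exists_isEdgeWalk hab hab'
  obtain ⟨v, hv, hmin⟩ := exists_lexMin_isEdgeWalk c hex
  have hk : 1 ≤ k := by
    rw [← hreg a, Nat.one_le_iff_ne_zero, ← Nat.pos_iff_ne_zero, degree_pos_iff_exists_adj]
    exact ⟨b, hab⟩
  have hfirst : c (v 0) (v 1) = c a b := by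
    rcases hv.first with h | h <;> rw [h.1, h.2]
    exact hsymm _ _
  have hlast : c (v m) (v (m + 1)) = c a' b' := by
    rcases hv.last with h | h <;> rw [h.1, h.2]
    exact hsymm _ _
  -- Short walks need no counting of vertices: each step changes the color by at most k - 1, and 4(k
  -- - 1) ≤ N - 4 by `hcard`. For m = 3 the two ends of the walk could share a neighbor, which would
  -- spoil the count below.
  rcases Nat.lt_or_ge m 5 with hm5 | hm5
  · have hstep : ∀ i ≤ m, c (v i) (v (i + 1)) + i ≤ c (v 0) (v 1) + i * k := by
      intro i
      induction i with
      | zero => simp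
      | succ i ih =>
        intro hi
        have ih := ih (by omega)
        obtain ⟨l, hl⟩ := hc (v (i + 1))
        have hmem : ∀ y, H.Adj (v (i + 1)) y → c (v (i + 1)) y ∈ Finset.Ico l (l + k) :=
          fun y h => by rw [← hl]; exact Finset.mem_image_of_mem _ (by simpa using h)
        have h1 := hmem _ (hv.adj i (by omega)).symm
        have h2 := hmem _ (hv.adj (i + 1) hi)
        rw [hsymm, Finset.mem_Ico] at h1
        rw [Finset.mem_Ico] at h2
        rw [Nat.add_mul]
        omega
    have h := hstep m le_rfl
    rw [hfirst, hlast] at h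
    interval_cases m <;> omega
  -- The level determines the position on the walk, except that `v 0` shares level 1 with `v 1`, and
  -- `v (m + 1)` may share level `m` with `v m`. The bipartition `s` separates these pairs.
  have hLv : ∀ i ≤ m + 1, min i m ≤ L (v i) ∧ L (v i) ≤ max i 1 := by
    have h0 : L (v 0) = 1 ∧ L (v 1) = 1 := by
      rcases hv.first with h | h <;> rw [h.1, h.2] <;> exact ⟨‹_›, ‹_›⟩
    have h1 : m ≤ L (v m) ∧ m ≤ L (v (m + 1)) := by
      rcases hv.last with h | h <;> rw [h.1, h.2] <;> exact ⟨‹_›, ‹_›⟩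
    have hup : ∀ i ≤ m, L (v (i + 1)) ≤ i + 1 := by
      intro i
      induction i with
      | zero => intro _; exact h0.2.le
      | succ i ih =>
        intro hi
        have := hL _ _ (hv.adj (i + 1) hi)
        have := ih (by omega)
        omega
    have hlow : ∀ j ≤ m, m ≤ L (v (m - j)) + j := by
      intro j
      induction j with
      | zero => intro _; exact h1.1
      | succ j ih =>
        intro hj
        have h := hL _ _ (hv.adj (m - (j + 1)) (by omega))
        rw [show m - (j + 1) + 1 = m - j by omega] at h
        have := ih (by omega)
        omega
    intro i hi
    constructor
    · rcases Nat.lt_or_ge m i with h | h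
      · obtain rfl : i = m + 1 := by omega
        have := h1.2
        omega
      · have := hlow (m - i) (by omega)
        rw [show m - (m - i) = i by omega] at this
        omega
    · rcases i with _ | i
      · rw [h0.1]; simp
      · have := hup i (by omega)
        omega
  have hsv : ∀ i ≤ m + 1, s (v i) = s (v 0) ↔ i % 2 = 0 := by
    intro i
    induction i with
    | zero => simp
    | succ i ih =>
      intro hi
      have h1 := ih (by omega)
      have h2 := hs _ _ (hv.adj i (by omega))
      have h3 : s (v (i + 1)) = s (v 0) ↔ ¬ s (v i) = s (v 0) := by
        revert h2; cases s (v i) <;> cases s (v (i + 1)) <;> cases s (v 0) <;> simp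
      rw [h3, h1]; omega
  have hne : ∀ i j, i < j → j ≤ m + 1 → v i ≠ v j := by
    intro i j hij hj h
    have h1 := hLv i (by omega)
    have h2 := hLv j hj
    have h3 := hsv i (by omega)
    have h4 := hsv j hj
    rw [h] at h1 h3
    rw [h3] at h4
    omega
  have hadj : ∀ i j, i < j → j ≤ m + 1 → H.Adj (v i) (v j) → j = i + 1 := by
    intro i j hij hj h
    have h1 := hLv i (by omega)
    have h2 := hLv j hj
    have h3 := hsv i (by omega)
    have h4 := hsv j hj
    have h5 := hL _ _ h
    have h6 : s (v j) = s (v 0) ↔ ¬ s (v i) = s (v 0) := by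
      have := hs _ _ h
      revert this; cases s (v i) <;> cases s (v j) <;> cases s (v 0) <;> simp
    rw [h3, h4] at h6
    omega
  have hcommon : ∀ i j w, i < j → j ≤ m + 1 → H.Adj (v i) w → H.Adj (v j) w → j = i + 2 := by
    intro i j w hij hj hi' hj'
    have h1 := hLv i (by omega)
    have h2 := hLv j hj
    have h3 := hsv i (by omega)
    have h4 := hsv j hj
    have h5 := hL _ _ hi'
    have h5' := hL _ _ hj'.symm
    have h6 : s (v j) = s (v 0) ↔ s (v i) = s (v 0) := by
      have h7 := hs _ _ hi'
      have h8 := hs _ _ hj'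
      revert h7 h8; cases s (v i) <;> cases s w <;> cases s (v j) <;> cases s (v 0) <;> simp
    rw [h3, h4] at h6
    omega
  -- The neighbors skipped at `v (i + 1)`; empty if the color does not rise there.
  let M : ℕ → Finset W := fun i =>
    {w ∈ H.neighborFinset (v (i + 1)) | c (v (i + 1)) (v i) < c (v (i + 1)) w ∧
      c (v (i + 1)) w < c (v (i + 1)) (v (i + 2))}
  have hM : ∀ {i w}, w ∈ M i ↔ H.Adj (v (i + 1)) w ∧ c (v (i + 1)) (v i) < c (v (i + 1)) w ∧
      c (v (i + 1)) w < c (v (i + 1)) (v (i + 2)) := by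
    intro i w; simp [M]
  have hMne : ∀ {i w}, w ∈ M i → w ≠ v i ∧ w ≠ v (i + 2) := by
    intro i w hw
    rw [hM] at hw
    exact ⟨fun h => by rw [h] at hw; omega, fun h => by rw [h] at hw; omega⟩
  have hMcard : ∀ i < m, c (v (i + 1)) (v (i + 2)) ≤ c (v i) (v (i + 1)) + (M i).card + 1 := by
    intro i hi
    obtain ⟨l, hl⟩ := hc (v (i + 1))
    rw [hsymm (v i)]
    exact le_card_filter_between hl (hv.adj i (by omega)).symm (hv.adj (i + 1) hi)
  -- Rerouting through a common `w` instead of `v (i + 2)` keeps all earlier colors and lowers that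
  -- of the edge leaving `v (i + 1)`.
  have hMdisj : ∀ i, i + 3 ≤ m → Disjoint (M i) (M (i + 2)) := by
    intro i hi
    rw [Finset.disjoint_left]
    intro w h1 h2
    rw [hM] at h1 h2
    have := hmin _ (hv.update (i := i + 1) (by omega) hi h1.1 h2.1) (i + 1) (by omega)
      (fun j hj => by simp [Function.update_of_ne, show j ≠ i + 1 + 1 by omega,
        show j ≠ i + 1 by omega])
    simp only [Function.update_self, Function.update_of_ne (show i + 1 ≠ i + 1 + 1 by omega)]
      at this
    change c (v (i + 1)) (v (i + 2)) ≤ _ at this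
    omega
  -- Besides `y`, the vertex `x` has k - 1 neighbors, while `M i` has at most k - 2 elements, since
  -- it omits both walk neighbors of `v (i + 1)`.
  have hend : ∀ x i, i < m → ∀ y, H.Adj x y → (y = v i ∨ y = v (i + 2)) →
      ∃ w, H.Adj x w ∧ w ≠ y ∧ w ∉ M i := by
    intro x i hi y hxy hy
    by_contra! hcon
    have hsub : (H.neighborFinset x).erase y ⊆
        ((H.neighborFinset (v (i + 1))).erase (v i)).erase (v (i + 2)) := by
      intro w hw
      simp only [Finset.mem_erase, mem_neighborFinset] at hw ⊢
      have hwM := hcon w hw.2 hw.1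
      exact ⟨(hMne hwM).2, (hMne hwM).1, (hM.1 hwM).1⟩
    have h := Finset.card_le_card hsub
    rw [Finset.card_erase_of_mem (by simpa using hxy), Finset.card_erase_of_mem,
      Finset.card_erase_of_mem, card_neighborFinset_eq_degree, card_neighborFinset_eq_degree,
      hreg, hreg] at h
    · have h2 : 1 < (H.neighborFinset (v (i + 1))).card :=
        Finset.one_lt_card.2 ⟨v i, by simpa using (hv.adj i (by omega)).symm, v (i + 2),
          by simpa using hv.adj (i + 1) hi, hne _ _ (by omega) (by omega)⟩
      rw [card_neighborFinset_eq_degree, hreg] at h2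
      omega
    · simpa using (hv.adj i (by omega)).symm
    · simpa using ⟨(hne _ _ (by omega) (by omega)).symm, hv.adj (i + 1) hi⟩
  obtain ⟨w₀, hw₀, hw₀', hw₀M⟩ := hend (v 0) 1 (by omega) (v 1) (hv.adj 0 (by omega)) (.inl rfl)
  obtain ⟨w₁, hw₁, hw₁', hw₁M⟩ := hend (v (m + 1)) (m - 2) (by omega) (v m)
    (hv.adj m le_rfl).symm (.inr (by rw [show m - 2 + 2 = m by omega]))
  -- Indexed so that `U i` consists of neighbors of `v i`. Two of these sets can meet only when
  -- their indices differ by 2, so each spare vertex has a single `M` to avoid.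
  let U : ℕ → Finset W := fun i => if i = 0 then {w₀} else if i = m + 1 then {w₁} else M (i - 1)
  have hU0 : U 0 = {w₀} := rfl
  have hU1 : U (m + 1) = {w₁} := by simp [U]
  have hUM : ∀ i < m, U (i + 1) = M i := by
    intro i hi; simp [U, show i ≠ m by omega]
  have hcases : ∀ i ≤ m + 1, i = 0 ∨ i = m + 1 ∨ ∃ j < m, i = j + 1 := by
    intro i hi
    rcases i with _ | i
    · simp
    · rcases Nat.lt_or_ge i m with h | h
      · exact .inr (.inr ⟨i, h, rfl⟩)
      · exact .inr (.inl (by omega))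
  have hUadj : ∀ i ≤ m + 1, ∀ w ∈ U i, H.Adj (v i) w := by
    intro i hi w hw
    rcases hcases i hi with rfl | rfl | ⟨j, hj, rfl⟩
    · rw [hU0, Finset.mem_singleton] at hw; rwa [hw]
    · rw [hU1, Finset.mem_singleton] at hw; rwa [hw]
    · rw [hUM j hj] at hw; exact (hM.1 hw).1
  have hUne : ∀ i ≤ m + 1, ∀ j ≤ m + 1, v j ∉ U i := by
    intro i hi j hj hw
    have hA := hUadj i hi _ hw
    have hor : j = i + 1 ∨ i = j + 1 := by
      rcases lt_trichotomy i j with h | rfl | h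
      · exact .inl (hadj i j h hj hA)
      · exact absurd hA (H.loopless.irrefl _)
      · exact .inr (hadj j i h hi hA.symm)
    rcases hcases i hi with rfl | rfl | ⟨l, hl, rfl⟩
    · obtain rfl : j = 1 := by omega
      rw [hU0, Finset.mem_singleton] at hw
      exact hw₀' hw.symm
    · obtain rfl : j = m := by omega
      rw [hU1, Finset.mem_singleton] at hw
      exact hw₁' hw.symm
    · rw [hUM l hl] at hw
      rcases hor with rfl | h
      · exact (hMne hw).2 rfl
      · obtain rfl : j = l := by omega
        exact (hMne hw).1 rfl
  have hUdisj' : ∀ i j, i < j → j ≤ m + 1 → Disjoint (U i) (U j) := by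
    intro i j hij hj
    by_contra hcon
    obtain ⟨w, hi', hj'⟩ := Finset.not_disjoint_iff.1 hcon
    obtain rfl := hcommon i j w hij hj (hUadj i (by omega) w hi') (hUadj j hj w hj')
    rcases i with _ | i
    · rw [hU0, Finset.mem_singleton] at hi'
      rw [hUM 1 (by omega), hi'] at hj'
      exact hw₀M hj'
    · rcases Nat.lt_or_ge (i + 2) m with h | h
      · rw [hUM i (by omega)] at hi'
        rw [show i + 1 + 2 = i + 2 + 1 by omega, hUM (i + 2) h] at hj'
        exact Finset.disjoint_left.1 (hMdisj i (by omega)) hi' hj'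
      · obtain rfl : m = i + 2 := by omega
        rw [hUM i (by omega)] at hi'
        rw [show i + 1 + 2 = i + 2 + 1 by omega, hU1, Finset.mem_singleton] at hj'
        rw [hj'] at hi'
        exact hw₁M hi'
  have hUdisj : Set.PairwiseDisjoint (↑(Finset.range (m + 2))) U := by
    intro i hi j hj hij
    simp only [Finset.coe_range, Set.mem_Iio] at hi hj
    rcases lt_or_gt_of_ne hij with h | h
    · exact hUdisj' i j h (by omega)
    · exact (hUdisj' j i h (by omega)).symm
  have hinj : Set.InjOn v (↑(Finset.range (m + 2))) := by
    intro i hi j hj h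
    simp only [Finset.coe_range, Set.mem_Iio] at hi hj
    by_contra hij
    rcases lt_or_gt_of_ne hij with h' | h'
    · exact hne i j h' (by omega) h
    · exact hne j i h' (by omega) h.symm
  have hcount : (m + 2) + ∑ i ∈ Finset.range (m + 2), (U i).card ≤ Fintype.card W := by
    rw [← Finset.card_biUnion hUdisj]
    have him := Finset.card_image_of_injOn hinj
    rw [Finset.card_range] at him
    nth_rw 1 [← him]
    rw [← Finset.card_union_of_disjoint]
    · exact Finset.card_le_univ _
    · rw [Finset.disjoint_left]
      intro x hx hx'
      obtain ⟨j, hj, rfl⟩ := Finset.mem_image.1 hx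
      obtain ⟨i, hi, hx'⟩ := Finset.mem_biUnion.1 hx'
      rw [Finset.mem_range] at hi hj
      exact hUne i (by omega) j (by omega) hx'
  rw [Finset.sum_range_succ, Finset.sum_range_succ', hU0, hU1, Finset.card_singleton,
    Finset.card_singleton, Finset.sum_congr rfl fun i hi => by
      rw [hUM i (Finset.mem_range.1 hi)]] at hcount
  have htel : ∀ i ≤ m, c (v i) (v (i + 1)) ≤
      c (v 0) (v 1) + ∑ j ∈ Finset.range i, (M j).card + i := by
    intro i
    induction i with
    | zero => simp
    | succ i ih =>
      intro hi
      have h1 := ih (by omega)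
      have h2 := hMcard i (by omega)
      rw [Finset.sum_range_succ]
      rw [show i + 1 + 1 = i + 2 by omega]
      omega
  have := htel m le_rfl
  rw [hfirst, hlast] at this
  omega

/-! ### The double cover with rungs -/

/-- The bipartite double cover of `G` together with the edges joining the two copies of each
vertex. -/
def loopedDoubleCover {V : Type*} (G : SimpleGraph V) : SimpleGraph (V × Bool) where
  Adj x y := x.2 ≠ y.2 ∧ (x.1 = y.1 ∨ G.Adj x.1 y.1)
  symm := ⟨fun _ _ h => ⟨h.1.symm, h.2.imp Eq.symm Adj.symm⟩⟩
  loopless := ⟨fun _ h => h.1 rfl⟩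

theorem loopedDoubleCover_adj {V : Type*} {G : SimpleGraph V} {x y : V × Bool} :
    G.loopedDoubleCover.Adj x y ↔ x.2 ≠ y.2 ∧ (x.1 = y.1 ∨ G.Adj x.1 y.1) := Iff.rfl

theorem neighborFinset_loopedDoubleCover {V : Type*} [Fintype V] [DecidableEq V]
    (G : SimpleGraph V) [DecidableRel G.Adj] [DecidableRel G.loopedDoubleCover.Adj]
    (x : V × Bool) :
    G.loopedDoubleCover.neighborFinset x =
      (insert x.1 (G.neighborFinset x.1)).image fun y => (y, !x.2) := by
  ext ⟨y, j⟩
  simp only [mem_neighborFinset, loopedDoubleCover_adj, Finset.mem_image, Finset.mem_insert,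
    Prod.mk.injEq]
  constructor
  · rintro ⟨h1, h2⟩
    refine ⟨y, h2.imp Eq.symm id, rfl, ?_⟩
    cases j <;> cases h : x.2 <;> simp_all
  · rintro ⟨z, h, rfl, rfl⟩
    exact ⟨by simp, h.imp Eq.symm id⟩

theorem IsRegularOfDegree.loopedDoubleCover {V : Type*} [Fintype V] [DecidableEq V]
    {G : SimpleGraph V} [DecidableRel G.Adj] [DecidableRel G.loopedDoubleCover.Adj] {r : ℕ}
    (h : G.IsRegularOfDegree r) : G.loopedDoubleCover.IsRegularOfDegree (r + 1) := by
  intro x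
  rw [← card_neighborFinset_eq_degree, neighborFinset_loopedDoubleCover,
    Finset.card_image_of_injective _ fun _ _ h => (Prod.mk.inj h).1,
    Finset.card_insert_of_notMem (by simp), card_neighborFinset_eq_degree, h]

/-- A rung lets a walk change copies at any vertex, so every step of a walk in `G` lifts, whether or
not `G` is bipartite. -/
theorem Connected.loopedDoubleCover {V : Type*} {G : SimpleGraph V} (h : G.Connected) :
    G.loopedDoubleCover.Connected := by
  have hflip : ∀ (x : V) (i j : Bool), G.loopedDoubleCover.Reachable (x, i) (x, j) := by
    intro x i j
    rcases eq_or_ne i j with rfl | hij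
    · exact .refl _
    · exact Adj.reachable ⟨hij, .inl rfl⟩
  have hwalk : ∀ (x y : V), G.Walk x y → G.loopedDoubleCover.Reachable (x, true) (y, true) := by
    intro x y p
    induction p with
    | nil => exact .refl _
    | @cons u v w huv p ih =>
      have hadj : G.loopedDoubleCover.Adj (u, true) (v, false) := ⟨by simp, .inr huv⟩
      exact (hadj.reachable.trans (hflip v _ _)).trans ih
  obtain ⟨x₀⟩ := h.nonempty
  have : Nonempty (V × Bool) := ⟨(x₀, true)⟩
  refine ⟨fun x y => ?_⟩
  obtain ⟨p⟩ := h.preconnected x.1 y.1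
  exact ((hflip _ _ _).trans (hwalk _ _ p)).trans (hflip _ _ _)

/-! ### Transferring the coloring to the cover -/

/-- An interval coloring of a regular graph, as a symmetric function on pairs of vertices. -/
theorem IsIntervalColoring.exists_color_pairs {V : Type*} [Fintype V] {G : SimpleGraph V}
    [DecidableRel G.Adj] {r t : ℕ} (hreg : G.IsRegularOfDegree r) (hr : 1 ≤ r)
    {α : G.edgeSet → ℕ} (hα : G.IsIntervalColoring t α) :
    ∃ (β : V → V → ℕ) (l : V → ℕ), (∀ x y, β x y = β y x) ∧
      (∀ x, (G.neighborFinset x).image (β x) = Finset.Ico (l x) (l x + r)) ∧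
      (∀ x, 1 ≤ l x) ∧ ∀ i ∈ Set.Icc 1 t, ∃ x y, G.Adj x y ∧ β x y = i := by
  classical
  let β : V → V → ℕ := fun x y => if h : G.Adj x y then α ⟨s(x, y), h⟩ else 0
  have hβ : ∀ {x y} (h : G.Adj x y), β x y = α ⟨s(x, y), h⟩ := fun h => dif_pos h
  have himage : ∀ x, ((G.neighborFinset x).image (β x) : Set ℕ) = α '' G.edgesAt x := by
    intro x
    ext i
    simp only [Finset.coe_image, Set.mem_image, Finset.mem_coe, mem_neighborFinset]
    constructor
    · rintro ⟨y, hy, rfl⟩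
      exact ⟨⟨s(x, y), hy⟩, by simp [edgesAt], (hβ hy).symm⟩
    · rintro ⟨⟨e, he⟩, hx, rfl⟩
      obtain ⟨y, rfl⟩ := Sym2.mem_iff_exists.1 (show x ∈ e from hx)
      exact ⟨y, he, hβ he⟩
  have hinj : ∀ x, Set.InjOn (β x) (G.neighborFinset x) := by
    intro x y hy z hz h
    simp only [Finset.mem_coe, mem_neighborFinset] at hy hz
    rw [hβ hy, hβ hz] at h
    have := hα.injOn x (by simp [edgesAt]) (by simp [edgesAt]) h
    exact Sym2.congr_right.1 (Subtype.ext_iff.1 this)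
  have hl : ∀ x, ∃ l, 1 ≤ l ∧ (G.neighborFinset x).image (β x) = Finset.Ico l (l + r) := by
    intro x
    obtain ⟨a, b, hab⟩ := hα.interval x
    have heq : (G.neighborFinset x).image (β x) = Finset.Icc a b := by
      rw [← Finset.coe_inj, himage, hab, Finset.coe_Icc]
    have hcard := Finset.card_image_of_injOn (hinj x)
    rw [heq, card_neighborFinset_eq_degree, hreg, Nat.card_Icc] at hcard
    refine ⟨a, ?_, ?_⟩
    · have ha : a ∈ α '' G.edgesAt x := by rw [hab, Set.mem_Icc]; omega
      obtain ⟨e, -, rfl⟩ := ha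
      exact (hα.mem_Icc e).1
    · rw [heq]
      ext i
      simp only [Finset.mem_Icc, Finset.mem_Ico]
      omega
  choose l hl1 hl2 using hl
  refine ⟨β, l, fun x y => ?_, hl2, hl1, fun i hi => ?_⟩
  · by_cases h : G.Adj x y
    · rw [hβ h, hβ h.symm]
      congr 2
      exact Sym2.eq_swap
    · simp only [β, dif_neg h, dif_neg fun h' : G.Adj y x => h h'.symm]
  · obtain ⟨⟨e, he⟩, rfl⟩ := hα.exists_eq i hi
    induction e with
    | _ x y => exact ⟨x, y, he, hβ he⟩

/-- The number of colors in an interval coloring of a connected regular graph. -/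
theorem IsIntervalColoring.add_five_le {V : Type*} [Fintype V] {G : SimpleGraph V}
    [DecidableRel G.Adj] {r t : ℕ} (hconn : G.Connected) (hreg : G.IsRegularOfDegree r)
    (hcard : 2 * r + 2 ≤ Fintype.card V) (ht : 1 ≤ t) {α : G.edgeSet → ℕ}
    (hα : G.IsIntervalColoring t α) : t + 5 ≤ 2 * Fintype.card V := by
  classical
  have hr : 1 ≤ r := by
    obtain ⟨⟨e, he⟩, -⟩ := hα.exists_eq 1 ⟨le_rfl, ht⟩
    induction e with
    | _ x y =>
      rw [← hreg x, Nat.one_le_iff_ne_zero, ← Nat.pos_iff_ne_zero, degree_pos_iff_exists_adj]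
      exact ⟨y, he⟩
  obtain ⟨β, l, hsymm, hl, hl1, hex⟩ := hα.exists_color_pairs hreg hr
  have hmem : ∀ {x y}, G.Adj x y → l x ≤ β x y ∧ β x y < l x + r := by
    intro x y h
    rw [← Finset.mem_Ico, ← hl]
    exact Finset.mem_image_of_mem _ (by simpa using h)
  obtain ⟨x₀, y₀, h₀, hβ₀⟩ := hex 1 ⟨le_rfl, ht⟩
  obtain ⟨x₁, y₁, h₁, hβ₁⟩ := hex t ⟨ht, le_rfl⟩
  have hx₀ : l x₀ = 1 := le_antisymm (hβ₀ ▸ (hmem h₀).1) (hl1 _)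
  -- If colors 1 and t meet at one vertex, then t ≤ r and the bound on |V| suffices.
  rcases eq_or_ne x₁ x₀ with rfl | hne
  · have := hmem h₁
    omega
  -- Rung colors. The colors at `x₀` are 1, …, r, so 0 extends them downward; elsewhere the rung
  -- extends the interval upward.
  let d : V → ℕ := fun x => if x = x₀ then 0 else l x + r
  let c : V × Bool → V × Bool → ℕ := fun x y => if x.1 = y.1 then d x.1 else β x.1 y.1
  have hc : ∀ x, ∃ a, (G.loopedDoubleCover.neighborFinset x).image (c x) =
      Finset.Ico a (a + (r + 1)) := by
    intro x
    have himage : (G.loopedDoubleCover.neighborFinset x).image (c x) =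
        insert (d x.1) (Finset.Ico (l x.1) (l x.1 + r)) := by
      rw [neighborFinset_loopedDoubleCover, Finset.image_image, Finset.image_insert, ← hl]
      congr 1
      · simp [c]
      · refine Finset.image_congr fun y hy => ?_
        have : x.1 ≠ y := G.ne_of_adj (by simpa using hy)
        simp [c, this]
    rw [himage]
    by_cases hx : x.1 = x₀
    · refine ⟨0, ?_⟩
      ext i
      simp only [d, hx, if_true, hx₀, Finset.mem_insert, Finset.mem_Ico]
      omega
    · refine ⟨l x.1, ?_⟩
      ext i
      simp only [d, hx, if_false, Finset.mem_insert, Finset.mem_Ico]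
      omega
  -- The two rungs compared have colors 0 and `l x₁ + r`, and the latter exceeds t; this gains one
  -- over comparing edges of colors 1 and t.
  have hfin := hconn.loopedDoubleCover.color_add_four_le hreg.loopedDoubleCover
    (s := Prod.snd) (fun x y h => h.1) (c := c)
    (fun x y => by
      by_cases h : x.1 = y.1
      · simp [c, h]
      · simp [c, h, Ne.symm h, hsymm x.1])
    hc (by rw [Fintype.card_prod, Fintype.card_bool]; omega)
    (a := (x₀, false)) (b := (x₀, true)) (a' := (x₁, false)) (b' := (x₁, true))
    ⟨by simp, .inl rfl⟩ ⟨by simp, .inl rfl⟩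
  rw [Fintype.card_prod, Fintype.card_bool] at hfin
  simp only [c, d, if_true, hne, if_false] at hfin
  have := hmem h₁
  omega

end SimpleGraph

theorem theorem7 {V : Type*} [Fintype V] (G : SimpleGraph V) [DecidableRel G.Adj] (r : ℕ)
    (hconn : G.Connected) (hreg : G.IsRegularOfDegree r)
    (hcard : 2 * r + 2 ≤ Fintype.card V) (hcol : G.IntervalColorable) :
    (G.maxIntervalColors : ℤ) ≤ 2 * (Fintype.card V : ℤ) - 5 := by
  obtain ⟨ht, α, hα⟩ := (SimpleGraph.isGreatest_maxIntervalColors hcol).1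
  have := hα.add_five_le hconn hreg hcard ht
  omega
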